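/- Let $\mathbb F_q$ be a finite field, and let $\sigma=\begin{pmatrix}a&b\\c&d\end{pmatrix}\in \mathrm{GL}_2(\mathbb F_q)$ with $dc\neq 0$. For $\tau=\begin{pmatrix}a'&b'\\c'&d'\end{pmatrix}\in\mathrm{GL}_2(\mathbb F_q)$ and a polynomial $f\in\mathbb F_q[x]$ of degree $n$ put $P_\tau(f)(x)=(c'x+d')^n f\left(\frac{a'x+b'}{c'x+d'}\right)$. For a positive integer $t$ put $S_t(f)(x)=f(x^t)$, and define the $R_{\sigma,t}$-transform by $g^{R_{\sigma,t}}=P_{\sigma^{-1}}(S_t(P_\sigma(g)))$. An element $\alpha\in\mathbb F_{q^n}$ is *normal* in $\mathbb F_{q^n}/\mathbb F_{q^s}$ (where $s\mid n$) if $\alpha,\alpha^{q^s},\dots,\alpha^{q^{s(n/s-1)}}$ are linearly independent over $\mathbb F_{q^s}$, and *completely normal* in $\mathbb F_{q^n}/\mathbb F_q$ if it is normal in $\mathbb F_{q^n}/\mathbb F_{q^s}$ for every divisor $s$ of $n$. A polynomial $f\in\mathbb F_q[x]$ is *completely normal* over $\mathbb F_q$ if it is irreducible and all its roots are completely normal in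 $\mathbb F_{q^{\deg f}}/\mathbb F_q$. **Theorem.** Let $A\in\mathbb F_q$ with $A\neq a/c$, let $g_0(x)=x-A$, and let $t\ge 2$ be an integer such that - every prime factor of $t$ divides $q-1$; - it is not the case that both $q\equiv 3 \pmod 4$ and $t$ is even; - for every prime $\ell\mid t$, the element $\eta(g_0;\sigma)=\left(-\frac dc\right)\, g_0\!\left(\frac bd\right)\, g_0\!\left(\frac ac\right)^{-1}$ is not an $\ell$-th power in $\mathbb F_q$. Define $g_k=g_{k-1}^{R_{\sigma,t}}$ for $k\ge 1$. Then: 1. If $ab=0$, then $g_k$ is completely normal over $\mathbb F_q$ for every $k\ge 0$. 2. If $ab\neq 0$ and $\frac{bc}{ad}$ is an $\ell$-th power in $\mathbb F_q$ for some prime $\ell\mid t$, then $g_k$ is completely normal over $\mathbb F_q$ for every $k\ge 1$, and also for $k=0$ provided that $A\neq 0$. 3. If $ab\neq 0$, $d=-c$ and $A\neq 0$, then $g_k$ is completely normal over $\mathbb F_q$ for every $k\ge 0$. -/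

import Mathlib

open Polynomial

namespace RTransform

universe u v

noncomputable section

/-- An element `α` of a (finite) extension `L / K` of a finite field `K` with `r = #K` is normal if
`α, α ^ r, …, α ^ (r ^ (m - 1))` are linearly independent over `K`, where `m = [L : K]`. -/
def IsNormalElement (K : Type u) (L : Type v) [Field K] [Field L] [Algebra K L] (α : L) : Prop :=
  LinearIndependent K
    (fun i : Fin (Module.finrank K L) => α ^ (Nat.card K ^ (i : ℕ)))

/-- `α` is completely normal in `L / K` if it is normal in `L / E` for every intermediate field `E`.
For `K = 𝔽_q` and `L = 𝔽_{q^n}` the intermediate fields are exactly the `𝔽_{q^d}` with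
`d ∣ n`. -/
def IsCompletelyNormalElement (K : Type u) (L : Type v) [Field K] [Field L] [Algebra K L]
    (α : L) : Prop :=
  ∀ E : IntermediateField K L, IsNormalElement E L α

/-- A polynomial over a finite field `F` is completely normal if it is irreducible and each of its
roots in an extension of degree `deg f` (that is, in `𝔽_{q^(deg f)}`) is completely normal. -/
def IsCompletelyNormalPoly {F : Type u} [Field F] (f : F[X]) : Prop :=
  Irreducible f ∧
    ∀ (L : Type u) [Field L] [Algebra F L], Module.finrank F L = f.natDegree →
      ∀ α : L, aeval α f = 0 → IsCompletelyNormalElement F L α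

variable {F : Type u} [Field F]

/-- `P_σ(f)(x) = (c x + d) ^ n * f ((a x + b) / (c x + d))` with `n = deg f`, as a polynomial. -/
def P (σ : Matrix.GeneralLinearGroup (Fin 2) F) (f : F[X]) : F[X] :=
  ∑ i ∈ Finset.range (f.natDegree + 1),
    C (f.coeff i) * (C (σ 0 0) * X + C (σ 0 1)) ^ i *
      (C (σ 1 0) * X + C (σ 1 1)) ^ (f.natDegree - i)

/-- The defining formula of `P` at a point where the denominator does not vanish. -/
theorem eval_P (σ : Matrix.GeneralLinearGroup (Fin 2) F) (f : F[X]) (x : F)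
    (hx : σ 1 0 * x + σ 1 1 ≠ 0) :
    (P σ f).eval x = (σ 1 0 * x + σ 1 1) ^ f.natDegree *
      f.eval ((σ 0 0 * x + σ 0 1) / (σ 1 0 * x + σ 1 1)) := by
  rw [P, eval_finsetSum, eval_eq_sum_range, Finset.mul_sum]
  refine Finset.sum_congr rfl fun i hi => ?_
  have hi' : i ≤ f.natDegree := Nat.lt_succ_iff.mp (Finset.mem_range.mp hi)
  simp only [eval_mul, eval_pow, eval_add, eval_C, eval_X]
  rw [div_pow, pow_sub₀ _ hx hi']
  field_simp

/-- `S_t(f)(x) = f(x ^ t)`. -/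
def S (t : ℕ) (f : F[X]) : F[X] := f.comp (X ^ t)

/-- The `R_{σ,t}`-transform `P_{σ⁻¹} ∘ S_t ∘ P_σ`. -/
def R (σ : Matrix.GeneralLinearGroup (Fin 2) F) (t : ℕ) (g : F[X]) : F[X] :=
  P σ⁻¹ (S t (P σ g))

/-- The sequence `g_0 = g`, `g_(k+1) = R_{σ,t}(g_k)`. -/
def gSeq (σ : Matrix.GeneralLinearGroup (Fin 2) F) (t : ℕ) (g : F[X]) : ℕ → F[X]
  | 0 => g
  | k + 1 => R σ t (gSeq σ t g k)

open Classical in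
/-- The element `η(g; σ)`, including the conventions for `c = 0` and for `d = 0`. -/
def eta (σ : Matrix.GeneralLinearGroup (Fin 2) F) (g : F[X]) : F :=
  if σ 1 0 = 0 then
    (-σ 1 1 / σ 0 0) ^ g.natDegree * g.eval (σ 0 1 / σ 1 1)
  else if σ 1 1 = 0 then
    (-σ 0 1 / σ 1 0) ^ g.natDegree * (g.eval (σ 0 0 / σ 1 0))⁻¹
  else
    (-σ 1 1 / σ 1 0) ^ g.natDegree * g.eval (σ 0 1 / σ 1 1) *
      (g.eval (σ 0 0 / σ 1 0))⁻¹

/-- The hypotheses of the Bassa–Menares irreducibility theorem on `σ`, `t` and `g`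
over the finite field `F` with `q = Nat.card F` elements. -/
structure BassaMenares (σ : Matrix.GeneralLinearGroup (Fin 2) F) (t : ℕ) (g : F[X]) : Prop where
  two_le : 2 ≤ t
  prime_dvd : ∀ ℓ : ℕ, ℓ.Prime → ℓ ∣ t → ℓ ∣ Nat.card F - 1
  monic : g.Monic
  irreducible : Irreducible g
  ne_pole : σ 1 0 ≠ 0 → g ≠ X - C (σ 0 0 / σ 1 0)
  even_degree : Nat.card F % 4 = 3 → Even t → Even g.natDegree
  eta_not_power : ∀ ℓ : ℕ, ℓ.Prime → ℓ ∣ t → ¬ ∃ y : F, eta σ g = y ^ ℓ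

end

end RTransform

/-!
`P_σ (x - A)` is a multiple of `x - η`, so the roots of `g_k` are the images under `σ` of the roots
`β` of `x ^ N - η` with `N = t ^ k`, that is, elements `u + v / (β - D)` with `D = -d / c`. Let `E`
be an intermediate field of `F(β) / F` and `m = [F(β) : E]`. The Frobenius of `E` permutes the lines
spanned by `1, β, …, β ^ (m - 1)`, and each of these powers generates a simple `E[X]`-module:
because exponents lift for the primes dividing `N`, it is annihilated by an irreducible binomial.
As Frobenius commutes with the projections onto the spans of the orbits, a polynomial in Frobenius
that kills an element all of whose coordinates are nonzero kills every power of `β`; hence such an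
element is normal. Expanding `1 / (β - D)` as a geometric series shows that only the constant
coordinate can vanish, and it does so exactly when `E = F` and `a η + b D ^ (N - 1) = 0`.
-/

namespace RTransform

/-- The numerical condition under which exponents lift: for every prime `p ∣ n` one has
`v_p (q ^ e - 1) = v_p (q - 1) + v_p e` for all `e ≠ 0`. -/
structure LiftsExponents (q n : ℕ) : Prop where
  prime_dvd_sub_one : ∀ p : ℕ, p.Prime → p ∣ n → p ∣ q - 1
  four_dvd_sub_one : 2 ∣ n → 4 ∣ q - 1

section Arithmetic

variable {q n : ℕ}

namespace LiftsExponents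

theorem of_dvd {m : ℕ} (h : LiftsExponents q n) (hmn : m ∣ n) : LiftsExponents q m where
  prime_dvd_sub_one p hp hpm := h.prime_dvd_sub_one p hp (hpm.trans hmn)
  four_dvd_sub_one h2 := h.four_dvd_sub_one (h2.trans hmn)

theorem pow_right (h : LiftsExponents q n) (k : ℕ) : LiftsExponents q (n ^ k) where
  prime_dvd_sub_one p hp hpn := h.prime_dvd_sub_one p hp (hp.dvd_of_dvd_pow hpn)
  four_dvd_sub_one h2 := h.four_dvd_sub_one (Nat.prime_two.dvd_of_dvd_pow h2)

theorem pow_left (h : LiftsExponents q n) (s : ℕ) : LiftsExponents (q ^ s) n where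
  prime_dvd_sub_one p hp hpn :=
    (h.prime_dvd_sub_one p hp hpn).trans (Nat.sub_one_dvd_pow_sub_one q s)
  four_dvd_sub_one h2 := (h.four_dvd_sub_one h2).trans (Nat.sub_one_dvd_pow_sub_one q s)

theorem not_prime_dvd (h : LiftsExponents q n) (hq : 1 < q) {p : ℕ} (hp : p.Prime) (hpn : p ∣ n) :
    ¬ p ∣ q := fun hpq =>
  hp.one_lt.ne' <| Nat.dvd_one.mp <| by
    simpa [Nat.sub_sub_self hq.le] using Nat.dvd_sub hpq (h.prime_dvd_sub_one p hp hpn)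

theorem coprime (h : LiftsExponents q n) (hq : 1 < q) : q.Coprime n :=
  (Nat.coprime_of_dvd fun _ hp hpn => h.not_prime_dvd hq hp hpn).symm

theorem factorization_pow_sub_one (h : LiftsExponents q n) (hq : 1 < q) {p : ℕ} (hp : p.Prime)
    (hpn : p ∣ n) {e : ℕ} (he : e ≠ 0) :
    (q ^ e - 1).factorization p = (q - 1).factorization p + e.factorization p := by
  have hpq := h.not_prime_dvd hq hp hpn
  have hlift : emultiplicity p (q ^ e - 1) = emultiplicity p (q - 1) + emultiplicity p e := by
    rcases hp.eq_two_or_odd' with rfl | hodd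
    · have h4 : (4 : ℤ) ∣ (q : ℤ) - 1 := by
        simpa [Nat.cast_sub hq.le] using Int.natCast_dvd_natCast.mpr (h.four_dvd_sub_one hpn)
      have := Int.two_pow_sub_pow' e h4 (by exact_mod_cast hpq)
      rw [← Int.natCast_emultiplicity, ← Int.natCast_emultiplicity, ← Int.natCast_emultiplicity]
      simpa [Nat.cast_sub hq.le, Nat.cast_sub (Nat.one_le_pow e q hq.le)] using this
    · simpa using Nat.emultiplicity_pow_sub_pow hp hodd (h.prime_dvd_sub_one p hp hpn) hpq e
  have hqe : q ^ e - 1 ≠ 0 := by have := Nat.one_lt_pow he hq; omega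
  rw [← padicValNat_eq_emultiplicity_of_ne_one hp.ne_one hqe,
    ← padicValNat_eq_emultiplicity_of_ne_one hp.ne_one (by omega : q - 1 ≠ 0),
    ← padicValNat_eq_emultiplicity_of_ne_one hp.ne_one he] at hlift
  simp only [Nat.factorization_def _ hp]
  exact_mod_cast hlift

theorem dvd_geomSum_iff (h : LiftsExponents q n) (hq : 1 < q) (hn : n ≠ 0) {e : ℕ} (he : e ≠ 0) :
    n ∣ ∑ i ∈ Finset.range e, q ^ i ↔ n ∣ e := by
  have hfac : (∑ i ∈ Finset.range e, q ^ i) * (q - 1) = q ^ e - 1 := geom_sum_mul_of_one_le hq.le e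
  have hqe : q ^ e - 1 ≠ 0 := by have := Nat.one_lt_pow he hq; omega
  have hsum : ∑ i ∈ Finset.range e, q ^ i ≠ 0 := left_ne_zero_of_mul (hfac ▸ hqe)
  rw [← Nat.factorization_prime_le_iff_dvd hn hsum, ← Nat.factorization_prime_le_iff_dvd hn he]
  refine forall₂_congr fun p hp => ?_
  by_cases hpn : p ∣ n
  · have := h.factorization_pow_sub_one hq hp hpn he
    rw [← hfac, Nat.factorization_mul hsum (by omega), Finsupp.add_apply] at this
    omega
  · simp [Nat.factorization_eq_zero_of_not_dvd hpn]

/-- The witness is `r = n / gcd (n, q - 1)`, the order of `q` modulo `n`. -/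
theorem exists_dvd_pow_sub_one (h : LiftsExponents q n) (hq : 1 < q) (hn : n ≠ 0) :
    ∃ r ≠ 0, r ∣ n ∧ n ∣ q ^ r - 1 ∧ ∀ l : ℕ, l.Prime → l ∣ r → ¬ n * l ∣ q ^ r - 1 := by
  set g := n.gcd (q - 1)
  obtain ⟨r, hr⟩ : g ∣ n := Nat.gcd_dvd_left _ _
  obtain ⟨hg0, hr0⟩ : g ≠ 0 ∧ r ≠ 0 := mul_ne_zero_iff.mp (hr ▸ hn)
  have hrn : r ∣ n := ⟨g, by rw [mul_comm, ← hr]⟩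
  refine ⟨r, hr0, hrn, ?_, fun l hl hlr hdvd => ?_⟩
  · rw [← geom_sum_mul_of_one_le hq.le r, mul_comm, hr]
    exact mul_dvd_mul (Nat.gcd_dvd_right _ _)
      (((h.of_dvd hrn).dvd_geomSum_iff hq hr0 hr0).mpr dvd_rfl)
  · have hqr : q ^ r - 1 ≠ 0 := by have := Nat.one_lt_pow hr0 hq; omega
    have hle := (Nat.factorization_prime_le_iff_dvd (mul_ne_zero hn hl.ne_zero) hqr).mpr hdvd l hl
    have hvr : 0 < r.factorization l := hl.factorization_pos_of_dvd hr0 hlr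
    have hvn : n.factorization l = g.factorization l + r.factorization l := by
      conv_lhs => rw [hr, Nat.factorization_mul hg0 hr0, Finsupp.add_apply]
    have hvg : g.factorization l = min (n.factorization l) ((q - 1).factorization l) := by
      rw [Nat.factorization_gcd hn (by omega), Finsupp.inf_apply]
    rw [h.factorization_pow_sub_one hq hl (hlr.trans hrn) hr0,
      Nat.factorization_mul hn hl.ne_zero, Finsupp.add_apply, hl.factorization_self] at hle
    omega

end LiftsExponents

theorem injective_finOfNat_mul {q m : ℕ} [NeZero m] (h : q.Coprime m) :
    Function.Injective fun i : Fin m => Fin.ofNat m (q * i) := fun i j hij => by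
  have hmod : q * i ≡ q * j [MOD m] := congrArg Fin.val hij
  exact Fin.ext <| (Nat.ModEq.cancel_left_of_coprime h.symm hmod).eq_of_lt_of_lt i.2 j.2

end Arithmetic

section Binomial

theorem exists_pow_eq_of_pow_card_div_eq_one {G : Type*} [CommGroup G] [IsCyclic G] [Finite G]
    {d : ℕ} (hd : d ∣ Nat.card G) {x : G} (hx : x ^ (Nat.card G / d) = 1) : ∃ y, y ^ d = x := by
  have hle : (powMonoidHom d : G →* G).range ≤ (powMonoidHom (Nat.card G / d) : G →* G).ker := by
    rintro _ ⟨y, rfl⟩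
    simp [MonoidHom.mem_ker, ← pow_mul, Nat.mul_div_cancel' hd]
  have heq := Subgroup.eq_of_le_of_card_ge hle <| by
    rw [IsCyclic.card_powMonoidHom_ker, IsCyclic.card_powMonoidHom_range,
      Nat.gcd_eq_right (Nat.div_dvd_of_dvd hd), Nat.gcd_eq_right hd]
  exact heq.ge hx

variable {K : Type*} [Field K] [Finite K] {n : ℕ}

theorem exists_pow_eq_of_pow_natCard_sub_one_div_eq_one {d : ℕ} (hd : d ∣ Nat.card K - 1) {x : K}
    (hx0 : x ≠ 0) (hx : x ^ ((Nat.card K - 1) / d) = 1) : ∃ y, y ^ d = x := by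
  rw [← Nat.card_units] at hd hx
  obtain ⟨y, hy⟩ := exists_pow_eq_of_pow_card_div_eq_one (x := Units.mk0 x hx0) hd
    (by ext; simpa using hx)
  exact ⟨y, by simpa using congrArg Units.val hy⟩

variable {L : Type*} [Field L] [Algebra K L]

theorem orderOf_pow_natCard_sub_one (hn : n ≠ 0)
    (hp : ∀ p : ℕ, p.Prime → p ∣ n → p ∣ Nat.card K - 1) {θ : K} (hθ0 : θ ≠ 0)
    (hθ : ∀ p : ℕ, p.Prime → p ∣ n → ∀ y : K, y ^ p ≠ θ) {β : L}
    (hβ : β ^ n = algebraMap K L θ) : orderOf (β ^ (Nat.card K - 1)) = n := by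
  have := Fintype.ofFinite K
  have hθ1 : θ ^ (Nat.card K - 1) = 1 := by
    simpa using FiniteField.pow_card_sub_one_eq_one θ hθ0
  refine orderOf_eq_of_pow_and_pow_div_prime (Nat.pos_of_ne_zero hn) ?_ fun p hpp hpn h1 => ?_
  · rw [pow_right_comm, hβ, ← map_pow, hθ1, map_one]
  · obtain ⟨y, hy⟩ := exists_pow_eq_of_pow_natCard_sub_one_div_eq_one (hp p hpp hpn) hθ0 <| by
      apply (algebraMap K L).injective
      rw [map_pow, map_one, ← hβ, ← h1, ← pow_mul, ← pow_mul]
      congr 1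
      rw [← Nat.mul_div_assoc _ hpn, ← Nat.mul_div_assoc _ (hp p hpp hpn), mul_comm]
    exact hθ p hpp hpn y hy

/-- If an irreducible factor has degree `e` and root `β`, then `β ^ (q - 1)` has order `n`, whereas
`β ^ (q ^ e) = β`; hence `n` divides `1 + q + ⋯ + q ^ (e - 1)`, which forces `n ∣ e`. -/
theorem irreducible_X_pow_sub_C (hn : n ≠ 0) (hq : LiftsExponents (Nat.card K) n) {θ : K}
    (hθ0 : θ ≠ 0) (hθ : ∀ p : ℕ, p.Prime → p ∣ n → ∀ y : K, y ^ p ≠ θ) :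
    Irreducible (X ^ n - C θ) := by
  have hq1 : 1 < Nat.card K := Finite.one_lt_card
  have hdeg : (X ^ n - C θ).natDegree = n := natDegree_X_pow_sub_C
  obtain ⟨g, hg, hgdvd⟩ := exists_irreducible_of_natDegree_ne_zero (hdeg.trans_ne hn)
  have hg_pos : g.natDegree ≠ 0 := hg.natDegree_pos.ne'
  have : Fact (Irreducible g) := ⟨hg⟩
  let β := AdjoinRoot.root g
  have root_of_dvd {f : K[X]} (hf : g ∣ f) : aeval β f = 0 :=
    eval₂_eq_zero_of_dvd_of_eval₂_eq_zero _ _ hf (AdjoinRoot.eval₂_root g)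
  have hβn : β ^ n = algebraMap K (AdjoinRoot g) θ := by
    simpa [sub_eq_zero] using root_of_dvd hgdvd
  have hβ0 : β ≠ 0 := fun h0 => hθ0 <| by
    rwa [h0, zero_pow hn, eq_comm, map_eq_zero] at hβn
  have hβe : β ^ Nat.card K ^ g.natDegree = β := by
    simpa [sub_eq_zero] using
      root_of_dvd (hg.natDegree_dvd_iff_dvd_X_pow_card_pow_sub_X.mp dvd_rfl)
  have hβ1 : (β ^ (Nat.card K - 1)) ^ (∑ i ∈ Finset.range g.natDegree, Nat.card K ^ i) = 1 := by
    rw [← pow_mul, mul_comm, geom_sum_mul_of_one_le hq1.le, ← mul_left_inj' hβ0, one_mul,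
      pow_sub_one_mul (pow_ne_zero _ (by omega)), hβe]
  rw [← orderOf_dvd_iff_pow_eq_one,
    orderOf_pow_natCard_sub_one hn hq.prime_dvd_sub_one hθ0 hθ hβn,
    hq.dvd_geomSum_iff hq1 hn hg_pos] at hβ1
  exact (associated_of_dvd_of_natDegree_le hgdvd (X_pow_sub_C_ne_zero (Nat.pos_of_ne_zero hn) θ)
    (hdeg.trans_le (Nat.le_of_dvd hg.natDegree_pos hβ1))).irreducible hg

end Binomial

section MonomialEndomorphism

variable {K M : Type*} [Field K] [AddCommGroup M] [Module K M] {φ : Module.End K M}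

/-- The cyclic `K[X]`-module generated by `x` is simple, so `x` is a multiple of any nonzero
`h • x`. -/
theorem aeval_apply_eq_zero_of_irreducible {μ : K[X]} (hμ : Irreducible μ) {x : M}
    (hμx : aeval φ μ x = 0) {f h : K[X]} (hx : aeval φ h x ≠ 0)
    (hf : aeval φ f (aeval φ h x) = 0) : aeval φ f x = 0 := by
  have hndvd : ¬ μ ∣ h := fun ⟨g, hg⟩ => hx <| by
    rw [hg, mul_comm, map_mul, Module.End.mul_apply, hμx, map_zero]
  obtain ⟨u, v, huv⟩ := hμ.coprime_iff_not_dvd.mpr hndvd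
  have hfx : f = f * u * μ + v * (f * h) := by linear_combination -f * huv
  rw [hfx, map_add, map_mul, map_mul _ v, map_mul _ f h]
  simp only [LinearMap.add_apply, Module.End.mul_apply, hμx, hf, map_zero, add_zero]

variable {ι : Type*} (b : Module.Basis ι K M) (π : Equiv.Perm ι)

open Classical in
/-- The projection onto the span of the basis vectors in the `π`-cycle of `j`, along the other basis
vectors. -/
noncomputable def cycleProjection (j : ι) : Module.End K M :=
  b.constr K fun i => if π.SameCycle j i then b i else 0

theorem cycleProjection_apply_of_sameCycle {i j : ι} (h : π.SameCycle j i) :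
    cycleProjection b π j (b i) = b i := by
  rw [cycleProjection, Module.Basis.constr_basis, if_pos h]

theorem cycleProjection_apply_of_not_sameCycle {i j : ι} (h : ¬ π.SameCycle j i) :
    cycleProjection b π j (b i) = 0 := by
  rw [cycleProjection, Module.Basis.constr_basis, if_neg h]

theorem repr_cycleProjection_self (j : ι) (v : M) :
    b.repr (cycleProjection b π j v) j = b.repr v j := by
  suffices b.coord j ∘ₗ cycleProjection b π j = b.coord j from LinearMap.congr_fun this v
  refine b.ext fun i => ?_
  by_cases h : π.SameCycle j i
  · simp [cycleProjection_apply_of_sameCycle b π h]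
  · have hij : i ≠ j := by rintro rfl; exact h (.refl π i)
    simp [cycleProjection_apply_of_not_sameCycle b π h, hij]

variable {b π} {s : ι → K}

theorem commute_cycleProjection (hφ : ∀ i, φ (b i) = s i • b (π i)) (j : ι) :
    Commute (cycleProjection b π j) φ := by
  refine b.ext fun i => ?_
  simp only [Module.End.mul_apply, hφ, map_smul]
  by_cases h : π.SameCycle j i
  · rw [cycleProjection_apply_of_sameCycle b π h, hφ,
      cycleProjection_apply_of_sameCycle b π (Equiv.Perm.sameCycle_apply_right.mpr h)]
  · rw [cycleProjection_apply_of_not_sameCycle b π h,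
      cycleProjection_apply_of_not_sameCycle b π (mt Equiv.Perm.sameCycle_apply_right.mp h),
      smul_zero, map_zero]

theorem exists_aeval_apply_eq_basis_pow_apply (hs : ∀ i, s i ≠ 0)
    (hφ : ∀ i, φ (b i) = s i • b (π i)) (j : ι) (e : ℕ) :
    ∃ h : K[X], aeval φ h (b j) = b ((π ^ e) j) := by
  induction e with
  | zero => exact ⟨1, by simp⟩
  | succ e ih =>
    obtain ⟨h, hh⟩ := ih
    refine ⟨C (s ((π ^ e) j))⁻¹ * (X * h), ?_⟩
    simp [hh, hφ, pow_succ', smul_smul, mul_inv_cancel₀ (hs _)]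

theorem exists_aeval_apply_eq_cycleProjection [Finite ι] (hs : ∀ i, s i ≠ 0)
    (hφ : ∀ i, φ (b i) = s i • b (π i)) (j : ι) (v : M) :
    ∃ h : K[X], aeval φ h (b j) = cycleProjection b π j v := by
  suffices LinearMap.range (cycleProjection b π j) ≤
      LinearMap.range ((LinearMap.applyₗ (b j)).comp (aeval φ).toLinearMap : K[X] →ₗ[K] M) from
    this ⟨v, rfl⟩
  rw [LinearMap.range_eq_map, ← b.span_eq, Submodule.map_span_le]
  rintro _ ⟨i, rfl⟩
  by_cases h : π.SameCycle j i
  · obtain ⟨e, -, rfl⟩ := h.exists_pow_eq'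
    obtain ⟨g, hg⟩ := exists_aeval_apply_eq_basis_pow_apply hs hφ j e
    exact ⟨g, by rw [cycleProjection_apply_of_sameCycle b π h, ← hg]; rfl⟩
  · rw [cycleProjection_apply_of_not_sameCycle b π h]
    exact Submodule.zero_mem _

theorem aeval_basis_eq_zero_of_repr_ne_zero [Finite ι] (hs : ∀ i, s i ≠ 0)
    (hφ : ∀ i, φ (b i) = s i • b (π i)) {f : K[X]} {v : M} (hf : aeval φ f v = 0) {j : ι}
    (hj : b.repr v j ≠ 0) {μ : K[X]} (hμ : Irreducible μ) (hμj : aeval φ μ (b j) = 0) :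
    aeval φ f (b j) = 0 := by
  obtain ⟨h, hh⟩ := exists_aeval_apply_eq_cycleProjection hs hφ j v
  have hcomm : Commute (cycleProjection b π j) (aeval φ f) :=
    Algebra.commute_of_mem_adjoin_singleton_of_commute (aeval_mem_adjoin_singleton K φ)
      (commute_cycleProjection hφ j)
  refine aeval_apply_eq_zero_of_irreducible hμ hμj (h := h) (fun h0 => hj ?_) ?_
  · rw [← repr_cycleProjection_self b π, ← hh, h0, map_zero, Finsupp.zero_apply]
  · rw [hh, ← Module.End.mul_apply, ← hcomm.eq, Module.End.mul_apply, hf, map_zero]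

end MonomialEndomorphism

section Frobenius

variable {K L : Type*} [Field K] [Field L] [Algebra K L]

theorem mem_range_algebraMap_of_pow_natCard_eq [Finite L] {x : L} (hx : x ^ Nat.card K = x) :
    x ∈ Set.range (algebraMap K L) := by
  have : Finite K := Finite.of_injective _ (algebraMap K L).injective
  have := Fintype.ofFinite K
  rw [IsGalois.mem_range_algebraMap_iff_fixed]
  intro f
  obtain ⟨i, rfl⟩ := (FiniteField.bijective_frobeniusAlgEquivOfAlgebraic_pow K L).2 f
  simp only [AlgEquiv.coe_pow, FiniteField.coe_frobeniusAlgEquivOfAlgebraic]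
  exact Function.iterate_fixed (by simpa using hx) _

theorem exists_algebraMap_eq_pow_of_orderOf_dvd [Finite L] {γ : L} {N : ℕ}
    (h : orderOf (γ ^ (Nat.card K - 1)) ∣ N) : ∃ w : K, algebraMap K L w = γ ^ N := by
  have : Finite K := Finite.of_injective _ (algebraMap K L).injective
  refine mem_range_algebraMap_of_pow_natCard_eq ?_
  rw [← pow_sub_one_mul Nat.card_pos.ne', pow_right_comm, orderOf_dvd_iff_pow_eq_one.mp h, one_mul]

theorem orderOf_pow_natCard_sub_one_dvd [Finite K] {γ : L} (hγ : γ ≠ 0) {N : ℕ} {w : K}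
    (hw : algebraMap K L w = γ ^ N) : orderOf (γ ^ (Nat.card K - 1)) ∣ N := by
  have := Fintype.ofFinite K
  have hw0 : w ≠ 0 := by
    rintro rfl
    exact pow_ne_zero N hγ (hw ▸ map_zero _)
  rw [orderOf_dvd_iff_pow_eq_one, pow_right_comm, ← hw, ← map_pow, Nat.card_eq_fintype_card,
    FiniteField.pow_card_sub_one_eq_one w hw0, map_one]

theorem orderOf_mul_dvd_of_algebraMap_pow_eq [Finite K] {γ : L} (hγ : γ ≠ 0) {N l : ℕ}
    (hl : l ∣ Nat.card K - 1) (hN : l ∣ N) {y : K} (hy : algebraMap K L (y ^ l) = γ ^ N) :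
    orderOf (γ ^ (Nat.card K - 1)) * l ∣ N := by
  have := Fintype.ofFinite K
  have hyl0 : y ^ l ≠ 0 := fun h0 => pow_ne_zero N hγ (by rw [← hy, h0, map_zero])
  have hl0 : l ≠ 0 := by
    rintro rfl
    exact (Nat.sub_pos_of_lt Finite.one_lt_card).ne' (Nat.zero_dvd.mp hl)
  have hy1 : y ^ (Nat.card K - 1) = 1 := by
    rw [Nat.card_eq_fintype_card, FiniteField.pow_card_sub_one_eq_one y (ne_zero_pow hl0 hyl0)]
  obtain ⟨u, rfl⟩ := hN
  obtain ⟨e, he⟩ := hl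
  rw [mul_comm l u]
  refine mul_dvd_mul_right (orderOf_dvd_of_pow_eq_one ?_) l
  rw [he, ← pow_mul, mul_right_comm, pow_mul, ← hy, ← map_pow, ← pow_mul, ← he, hy1, map_one]

variable [Fintype K]

theorem frobenius_pow_apply (i : ℕ) (x : L) :
    ((FiniteField.frobeniusAlgHom K L).toLinearMap ^ i) x = x ^ Nat.card K ^ i := by
  rw [Module.End.pow_apply, Nat.card_eq_fintype_card]
  exact congrFun (pow_iterate (Fintype.card K) i) x

theorem frobenius_apply_pow_of_pow_eq {m : ℕ} {β : L} {Θ : K} (hΘ : β ^ m = algebraMap K L Θ)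
    (i : ℕ) : (FiniteField.frobeniusAlgHom K L).toLinearMap (β ^ i) =
      Θ ^ (Nat.card K * i / m) • β ^ (Nat.card K * i % m) := by
  rw [← pow_one (FiniteField.frobeniusAlgHom K L).toLinearMap, frobenius_pow_apply, pow_one,
    Algebra.smul_def, map_pow, ← hΘ, ← pow_mul, ← pow_mul, ← pow_add, Nat.div_add_mod, mul_comm]

variable [Finite L]

/-- If `n` is the order of `γ ^ (q - 1)` and `n ∣ q ^ r - 1`, then `w = γ ^ (q ^ r - 1)` lies in
`K`, that is, Frobenius satisfies `X ^ r - w` at `γ`; this binomial is irreducible when `r` is the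
order of `q` modulo `n`. -/
theorem exists_irreducible_aeval_frobenius_eq_zero {m : ℕ} (hm : m ≠ 0)
    (hq : LiftsExponents (Nat.card K) m) {γ : L} (hγ : γ ≠ 0) {z : K}
    (hz : algebraMap K L z = γ ^ m) : ∃ μ : K[X], Irreducible μ ∧
      aeval (FiniteField.frobeniusAlgHom K L).toLinearMap μ γ = 0 := by
  have hnm := orderOf_pow_natCard_sub_one_dvd hγ hz
  have hqn := hq.of_dvd hnm
  obtain ⟨r, hr0, hrn, hdvd, hmax⟩ := hqn.exists_dvd_pow_sub_one Finite.one_lt_card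
    (ne_zero_of_dvd_ne_zero hm hnm)
  obtain ⟨w, hw⟩ := exists_algebraMap_eq_pow_of_orderOf_dvd hdvd
  refine ⟨X ^ r - C w, irreducible_X_pow_sub_C hr0 (hqn.of_dvd hrn) ?_ fun l hl hlr y hy => ?_, ?_⟩
  · rintro rfl
    exact pow_ne_zero _ hγ (hw ▸ map_zero _)
  · have hln := hlr.trans hrn
    exact hmax l hl hlr <| orderOf_mul_dvd_of_algebraMap_pow_eq hγ (hqn.prime_dvd_sub_one l hl hln)
      (hln.trans hdvd) (hy ▸ hw)
  · simp only [map_sub, map_pow, aeval_X, aeval_C, LinearMap.sub_apply,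
      Module.algebraMap_end_apply, frobenius_pow_apply]
    rw [Algebra.smul_def, hw, pow_sub_one_mul (pow_ne_zero _ Nat.card_pos.ne'), sub_self]

theorem isNormalElement_of_forall_aeval_eq_zero {α : L}
    (hα : ∀ f : K[X], aeval (FiniteField.frobeniusAlgHom K L).toLinearMap f α = 0 →
      aeval (FiniteField.frobeniusAlgHom K L).toLinearMap f = 0) : IsNormalElement K L α := by
  set φ := (FiniteField.frobeniusAlgHom K L).toLinearMap
  have hpow : LinearIndependent K fun i : Fin (Module.finrank K L) => φ ^ (i : ℕ) := by
    have := linearIndependent_pow (K := K) φ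
    rwa [FiniteField.minpoly_frobeniusAlgHom, ← C_1, natDegree_X_pow_sub_C] at this
  have heval : LinearIndependent K fun i : Fin (Module.finrank K L) => (φ ^ (i : ℕ)) α := by
    refine hpow.map (f := LinearMap.applyₗ α) (Submodule.disjoint_def.mpr fun ψ hψ hψα => ?_)
    obtain ⟨f, rfl⟩ : ∃ f : K[X], aeval φ f = ψ := by
      suffices Submodule.span K (Set.range fun i : Fin (Module.finrank K L) => φ ^ (i : ℕ)) ≤
        LinearMap.range (aeval φ : K[X] →ₐ[K] Module.End K L).toLinearMap from this hψ
      rw [Submodule.span_le]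
      rintro _ ⟨i, rfl⟩
      exact ⟨X ^ (i : ℕ), by simp⟩
    exact hα f hψα
  simpa only [φ, frobenius_pow_apply, IsNormalElement] using heval

end Frobenius

section PartialFraction

variable {K L : Type*} [Field K] [Field L] [Algebra K L]

theorem repr_algebraMap {R S : Type*} [CommRing R] [Ring S] [Nontrivial S] [Algebra R S]
    (pb : PowerBasis R S) (u : R) (i : Fin pb.dim) :
    pb.basis.repr (algebraMap R S u) i = if (i : ℕ) = 0 then u else 0 := by
  have h0 : algebraMap R S u = u • pb.basis ⟨0, pb.dim_pos⟩ := by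
    rw [pb.basis_eq_pow, pow_zero, Algebra.algebraMap_eq_smul_one]
  rw [h0, map_smul, pb.basis.repr_self, Finsupp.smul_apply, Finsupp.single_apply]
  simp [Fin.ext_iff, eq_comm]

theorem inv_gen_sub_algebraMap (pb : PowerBasis K L) {Θ D : K}
    (hΘ : pb.gen ^ pb.dim = algebraMap K L Θ) (hD : Θ ≠ D ^ pb.dim) :
    (pb.gen - algebraMap K L D)⁻¹ =
      ∑ i : Fin pb.dim, (D ^ (pb.dim - 1 - (i : ℕ)) / (Θ - D ^ pb.dim)) • pb.basis i := by
  have hΔ : algebraMap K L (Θ - D ^ pb.dim) ≠ 0 :=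
    (map_ne_zero (algebraMap K L)).mpr (sub_ne_zero.mpr hD)
  have hgeom := geom_sum₂_mul pb.gen (algebraMap K L D) pb.dim
  rw [Finset.sum_range, hΘ, ← map_pow, ← map_sub] at hgeom
  rw [← mul_right_inj' hΔ, ← hgeom,
    mul_inv_cancel_right₀ (right_ne_zero_of_mul (hgeom.trans_ne hΔ)), hgeom, Finset.mul_sum]
  refine Finset.sum_congr rfl fun i _ => ?_
  rw [Algebra.smul_def, map_div₀, map_pow, pb.basis_eq_pow, ← mul_assoc, mul_div_cancel₀ _ hΔ,
    mul_comm]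

theorem repr_inv_gen_sub_algebraMap (pb : PowerBasis K L) {Θ D : K}
    (hΘ : pb.gen ^ pb.dim = algebraMap K L Θ) (hD : Θ ≠ D ^ pb.dim) (i : Fin pb.dim) :
    pb.basis.repr (pb.gen - algebraMap K L D)⁻¹ i =
      D ^ (pb.dim - 1 - (i : ℕ)) / (Θ - D ^ pb.dim) := by
  rw [inv_gen_sub_algebraMap pb hΘ hD, pb.basis.repr_sum_self]

end PartialFraction

section Normality

variable {K L : Type*} [Field K] [Field L] [Algebra K L] [Finite L]

theorem isNormalElement_of_repr_ne_zero (pb : PowerBasis K L) {Θ : K} (hΘ0 : Θ ≠ 0)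
    (hΘ : pb.gen ^ pb.dim = algebraMap K L Θ) (hq : LiftsExponents (Nat.card K) pb.dim) {α : L}
    (hα : ∀ i, pb.basis.repr α i ≠ 0) : IsNormalElement K L α := by
  have : Finite K := Finite.of_injective _ (algebraMap K L).injective
  have := Fintype.ofFinite K
  have hm : pb.dim ≠ 0 := pb.dim_pos.ne'
  have : NeZero pb.dim := ⟨hm⟩
  let π : Equiv.Perm (Fin pb.dim) := Equiv.ofBijective _ <|
    Finite.injective_iff_bijective.mp (injective_finOfNat_mul (hq.coprime Finite.one_lt_card))
  have hφ (i : Fin pb.dim) : (FiniteField.frobeniusAlgHom K L).toLinearMap (pb.basis i) =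
      Θ ^ (Nat.card K * i / pb.dim) • pb.basis (π i) := by
    rw [pb.basis_eq_pow, frobenius_apply_pow_of_pow_eq hΘ, pb.basis_eq_pow]
    rfl
  refine isNormalElement_of_forall_aeval_eq_zero fun f hf => pb.basis.ext fun j => ?_
  obtain ⟨μ, hμ, hμj⟩ := exists_irreducible_aeval_frobenius_eq_zero (γ := pb.basis j) hm hq
    (pb.basis.ne_zero j) (z := Θ ^ (j : ℕ)) <| by
      rw [map_pow, ← hΘ, pb.basis_eq_pow, pow_right_comm]
  exact aeval_basis_eq_zero_of_repr_ne_zero (fun i => pow_ne_zero _ hΘ0) hφ hf (hα j) hμ hμj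

theorem isNormalElement_add_div (pb : PowerBasis K L) {Θ : K} (hΘ0 : Θ ≠ 0)
    (hΘ : pb.gen ^ pb.dim = algebraMap K L Θ) (hq : LiftsExponents (Nat.card K) pb.dim)
    {u v D : K} (hv : v ≠ 0) (hD : D ≠ 0) (hΘD : Θ ≠ D ^ pb.dim)
    (huv : u * (Θ - D ^ pb.dim) + v * D ^ (pb.dim - 1) ≠ 0) :
    IsNormalElement K L (algebraMap K L u + algebraMap K L v / (pb.gen - algebraMap K L D)) := by
  have hΔ : Θ - D ^ pb.dim ≠ 0 := sub_ne_zero.mpr hΘD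
  refine isNormalElement_of_repr_ne_zero pb hΘ0 hΘ hq fun i => ?_
  rw [map_add, Finsupp.add_apply, repr_algebraMap, div_eq_mul_inv, ← Algebra.smul_def, map_smul,
    Finsupp.smul_apply, repr_inv_gen_sub_algebraMap pb hΘ hΘD, smul_eq_mul]
  split_ifs with hi
  · rw [hi, Nat.sub_zero, mul_div_assoc', add_div' _ _ _ hΔ]
    exact div_ne_zero huv hΔ
  · rw [zero_add]
    exact mul_ne_zero hv (div_ne_zero (pow_ne_zero _ hD) hΔ)

end Normality

section CompleteNormality

open IntermediateField in
theorem adjoin_simple_eq_top_of_pow_finrank_eq {K L : Type*} [Field K] [Field L] [Algebra K L]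
    [FiniteDimensional K L] {θ : K} (hirr : Irreducible (X ^ Module.finrank K L - C θ)) {β : L}
    (hβ : β ^ Module.finrank K L = algebraMap K L θ) : K⟮β⟯ = ⊤ := by
  rw [Field.primitive_element_iff_minpoly_natDegree_eq,
    ← minpoly.eq_of_irreducible_of_monic hirr (by simp [hβ])
      (monic_X_pow_sub_C θ Module.finrank_pos.ne'), natDegree_X_pow_sub_C]

open IntermediateField in
theorem exists_powerBasis_gen_eq {K L : Type*} [Field K] [Field L] [Algebra K L]
    [FiniteDimensional K L] {β : L} (hβ : K⟮β⟯ = ⊤) : ∃ pb : PowerBasis K L, pb.gen = β :=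
  ⟨(IntermediateField.adjoin.powerBasis (.of_finite K β)).map
    ((IntermediateField.equivOfEq hβ).trans IntermediateField.topEquiv), by simp⟩

variable {F L : Type*} [Field F] [Finite F] [Field L] [Algebra F L] [FiniteDimensional F L]

theorem exists_algebraMap_eq_pow_finrank (hq : LiftsExponents (Nat.card F) (Module.finrank F L))
    {θ : F} (hθ0 : θ ≠ 0) {β : L} (hβ : β ^ Module.finrank F L = algebraMap F L θ)
    (E : IntermediateField F L) : ∃ Θ : E, algebraMap E L Θ = β ^ Module.finrank E L := by
  have : Finite L := Module.finite_of_finite F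
  have hq1 : 1 < Nat.card F := Finite.one_lt_card
  have hs0 : Module.finrank F E ≠ 0 := Module.finrank_pos.ne'
  have hβ0 : β ≠ 0 := fun h0 => hθ0 <| by
    rwa [h0, zero_pow Module.finrank_pos.ne', eq_comm, map_eq_zero] at hβ
  have hsum : Module.finrank F L ∣
      (∑ i ∈ Finset.range (Module.finrank F E), Nat.card F ^ i) * Module.finrank E L := by
    rw [← Module.finrank_mul_finrank F E L]
    have hqs := hq.of_dvd ⟨_, (Module.finrank_mul_finrank F E L).symm⟩
    exact mul_dvd_mul_right ((hqs.dvd_geomSum_iff hq1 hs0 hs0).mpr dvd_rfl) _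
  refine exists_algebraMap_eq_pow_of_orderOf_dvd (orderOf_dvd_of_pow_eq_one ?_)
  rw [Module.natCard_eq_pow_finrank (K := F), ← geom_sum_mul_of_one_le hq1.le, mul_comm _ (_ - 1),
    pow_mul, ← pow_mul]
  exact orderOf_dvd_iff_pow_eq_one.mp ((orderOf_pow_natCard_sub_one_dvd hβ0 hβ.symm).trans hsum)

theorem algebraMap_mul_sub_add_mul_ne_zero {F E : Type*} [Field F] [Field E] [Algebra F E]
    {s m : ℕ} {θ u v D : F} (hirr : Irreducible (X ^ (s * m) - C θ)) (hv : v ≠ 0) (hD : D ≠ 0)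
    (huv : u * (θ - D ^ (s * m)) + v * D ^ (s * m - 1) ≠ 0) {Θ : E}
    (hΘ : Θ ^ s = algebraMap F E θ) :
    algebraMap F E u * (Θ - algebraMap F E D ^ m) +
      algebraMap F E v * algebraMap F E D ^ (m - 1) ≠ 0 := by
  intro h0
  rcases eq_or_ne u 0 with rfl | hu
  · simp [hv, hD] at h0
  have hu' : algebraMap F E u ≠ 0 := (_root_.map_ne_zero _).mpr hu
  obtain ⟨z, rfl⟩ : ∃ z, algebraMap F E z = Θ := ⟨D ^ m - v * D ^ (m - 1) / u, by
    simp only [map_sub, map_div₀, map_mul, map_pow]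
    field_simp
    linear_combination -h0⟩
  have hzs : z ^ s = θ := (algebraMap F E).injective (by rw [map_pow, hΘ])
  obtain rfl : s = 1 := by
    by_contra hs
    exact pow_ne_of_irreducible_X_pow_sub_C hirr ⟨m, rfl⟩ hs z hzs
  rw [pow_one] at hzs
  refine huv ((algebraMap F E).injective ?_)
  simpa [← hzs] using h0

theorem isCompletelyNormalElement_add_div
    (hq : LiftsExponents (Nat.card F) (Module.finrank F L)) {θ : F} (hθ0 : θ ≠ 0)
    (hirr : Irreducible (X ^ Module.finrank F L - C θ)) {β : L}
    (hβ : β ^ Module.finrank F L = algebraMap F L θ) {u v D : F} (hv : v ≠ 0) (hD : D ≠ 0)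
    (hθD : θ ≠ D ^ Module.finrank F L)
    (huv : u * (θ - D ^ Module.finrank F L) + v * D ^ (Module.finrank F L - 1) ≠ 0) :
    IsCompletelyNormalElement F L
      (algebraMap F L u + algebraMap F L v / (β - algebraMap F L D)) := by
  intro E
  have : Finite L := Module.finite_of_finite F
  obtain ⟨Θ, hΘ⟩ := exists_algebraMap_eq_pow_finrank hq hθ0 hβ E
  obtain ⟨pb, rfl⟩ := exists_powerBasis_gen_eq
    (IntermediateField.adjoin_eq_top_of_adjoin_eq_top F (E := E)
      (adjoin_simple_eq_top_of_pow_finrank_eq hirr hβ))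
  have hsm : Module.finrank F E * pb.dim = Module.finrank F L := by
    rw [← pb.finrank, Module.finrank_mul_finrank]
  rw [pb.finrank] at hΘ
  rw [← hsm] at hq hirr hβ hθD huv
  have hΘs : Θ ^ Module.finrank F E = algebraMap F E θ := (algebraMap E L).injective <| by
    rw [map_pow, hΘ, ← pow_mul, mul_comm, hβ, ← IsScalarTower.algebraMap_apply]
  have hΘ0 : Θ ≠ 0 := by
    rintro rfl
    rw [zero_pow Module.finrank_pos.ne', eq_comm, map_eq_zero] at hΘs
    exact hθ0 hΘs
  have hΘD : Θ ≠ algebraMap F E D ^ pb.dim := by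
    rintro rfl
    rw [← pow_mul, mul_comm, ← map_pow] at hΘs
    exact hθD ((algebraMap F E).injective hΘs).symm
  have hqE : LiftsExponents (Nat.card E) pb.dim := by
    rw [Module.natCard_eq_pow_finrank (K := F)]
    exact (hq.of_dvd ⟨_, mul_comm _ _⟩).pow_left _
  have hvE : algebraMap F E v ≠ 0 := (_root_.map_ne_zero _).mpr hv
  have hDE : algebraMap F E D ≠ 0 := (_root_.map_ne_zero _).mpr hD
  simpa only [← IsScalarTower.algebraMap_apply] using
    isNormalElement_add_div pb hΘ0 hΘ.symm hqE hvE hDE hΘD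
      (algebraMap_mul_sub_add_mul_ne_zero hirr hv hD huv hΘs)

end CompleteNormality

section Moebius

variable {F : Type*} [Field F] (σ τ : Matrix.GeneralLinearGroup (Fin 2) F)
  {L : Type*} [Field L] [Algebra F L]

/-- The numerator `a x + b` of the Möbius transformation `x ↦ (a x + b) / (c x + d)` attached to
`σ`, acting on an extension field. -/
def moebiusNum (x : L) : L := algebraMap F L (σ 0 0) * x + algebraMap F L (σ 0 1)

/-- The denominator `c x + d` of the Möbius transformation attached to `σ`. -/
def moebiusDenom (x : L) : L := algebraMap F L (σ 1 0) * x + algebraMap F L (σ 1 1)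

/-- The Möbius transformation `x ↦ (a x + b) / (c x + d)` attached to `σ`, acting on the affine
line over an extension field. It takes the junk value `0` at the pole `-d / c`. -/
def moebius (x : L) : L := moebiusNum σ x / moebiusDenom σ x

variable {σ τ} {x : L}

theorem moebiusNum_mul (hx : moebiusDenom σ x ≠ 0) :
    moebiusNum (τ * σ) x = moebiusNum τ (moebius σ x) * moebiusDenom σ x := by
  rw [moebiusNum, moebiusNum, add_mul, mul_assoc, moebius, div_mul_cancel₀ _ hx]
  simp only [Units.val_mul, Matrix.mul_apply, Fin.sum_univ_two, map_add, map_mul, moebiusNum,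
    moebiusDenom]
  ring

theorem moebiusDenom_mul (hx : moebiusDenom σ x ≠ 0) :
    moebiusDenom (τ * σ) x = moebiusDenom τ (moebius σ x) * moebiusDenom σ x := by
  rw [moebiusDenom, moebiusDenom, add_mul, mul_assoc, moebius, div_mul_cancel₀ _ hx]
  simp only [Units.val_mul, Matrix.mul_apply, Fin.sum_univ_two, map_add, map_mul, moebiusNum,
    moebiusDenom]
  ring

theorem moebius_mul (hx : moebiusDenom σ x ≠ 0) :
    moebius (τ * σ) x = moebius τ (moebius σ x) := by
  rw [moebius, moebiusNum_mul hx, moebiusDenom_mul hx, mul_div_mul_right _ _ hx, ← moebius]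

theorem moebius_one : moebius (1 : Matrix.GeneralLinearGroup (Fin 2) F) x = x := by
  simp [moebius, moebiusNum, moebiusDenom]

theorem det_fin_two_ne_zero (σ : Matrix.GeneralLinearGroup (Fin 2) F) :
    σ 0 0 * σ 1 1 - σ 0 1 * σ 1 0 ≠ 0 := by
  simpa only [Matrix.det_fin_two] using σ.det_ne_zero

theorem moebiusNum_ne_zero_of_moebiusDenom_eq_zero (hx : moebiusDenom σ x = 0) :
    moebiusNum σ x ≠ 0 := fun h => by
  have hdet : algebraMap F L (σ 0 0 * σ 1 1 - σ 0 1 * σ 1 0) = 0 := by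
    simp only [map_sub, map_mul]
    rw [moebiusNum] at h
    rw [moebiusDenom] at hx
    linear_combination algebraMap F L (σ 0 0) * hx - algebraMap F L (σ 1 0) * h
  exact det_fin_two_ne_zero σ (by rwa [map_eq_zero] at hdet)

theorem moebiusDenom_ne_zero_of_notMem_range (hx : x ∉ Set.range (algebraMap F L)) :
    moebiusDenom σ x ≠ 0 := fun h => by
  rw [moebiusDenom] at h
  rcases eq_or_ne (σ 1 0) 0 with hc | hc
  · rw [hc, map_zero, zero_mul, zero_add, map_eq_zero] at h
    exact det_fin_two_ne_zero σ (by rw [hc, h, mul_zero, mul_zero, sub_zero])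
  · refine hx ⟨-σ 1 1 / σ 1 0, ?_⟩
    have hc' : algebraMap F L (σ 1 0) ≠ 0 := (_root_.map_ne_zero _).mpr hc
    rw [map_div₀, map_neg, div_eq_iff hc']
    linear_combination -h

theorem moebiusDenom_eq_mul_sub (hc : σ 1 0 ≠ 0) (x : L) :
    moebiusDenom σ x = algebraMap F L (σ 1 0) * (x - algebraMap F L (-σ 1 1 / σ 1 0)) := by
  rw [moebiusDenom, mul_sub, ← map_mul, mul_div_cancel₀ _ hc, map_neg, sub_neg_eq_add]

theorem moebius_eq_add_div (hc : σ 1 0 ≠ 0) (hx : moebiusDenom σ x ≠ 0) :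
    moebius σ x = algebraMap F L (σ 0 0 / σ 1 0) +
      algebraMap F L ((σ 0 1 * σ 1 0 - σ 0 0 * σ 1 1) / σ 1 0 ^ 2) /
        (x - algebraMap F L (-σ 1 1 / σ 1 0)) := by
  have hc' : algebraMap F L (σ 1 0) ≠ 0 := (_root_.map_ne_zero _).mpr hc
  have hxD : x - algebraMap F L (-σ 1 1 / σ 1 0) = moebiusDenom σ x / algebraMap F L (σ 1 0) := by
    rw [moebiusDenom_eq_mul_sub hc, mul_div_cancel_left₀ _ hc']
  rw [hxD, moebius, moebiusNum]
  simp only [map_div₀, map_sub, map_mul, map_pow]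
  field_simp
  rw [moebiusDenom]
  ring

end Moebius

section Transform

variable {F : Type*} [Field F] {σ τ : Matrix.GeneralLinearGroup (Fin 2) F} {f g : F[X]}

theorem aeval_P {L : Type*} [Field L] [Algebra F L] (f : F[X]) {x : L}
    (hx : moebiusDenom σ x ≠ 0) :
    aeval x (P σ f) = moebiusDenom σ x ^ f.natDegree * aeval (moebius σ x) f := by
  rw [P, map_sum, aeval_eq_sum_range, Finset.mul_sum]
  refine Finset.sum_congr rfl fun i hi => ?_
  have hi' : i ≤ f.natDegree := Nat.lt_succ_iff.mp (Finset.mem_range.mp hi)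
  simp only [map_mul, map_pow, map_add, aeval_C, aeval_X, Algebra.smul_def]
  rw [← moebiusNum, ← moebiusDenom, moebius, div_pow, pow_sub₀ _ hx hi']
  field_simp

theorem aeval_P_of_moebiusDenom_eq_zero {L : Type*} [Field L] [Algebra F L] (f : F[X]) {x : L}
    (hx : moebiusDenom σ x = 0) :
    aeval x (P σ f) = algebraMap F L f.leadingCoeff * moebiusNum σ x ^ f.natDegree := by
  rw [moebiusDenom] at hx
  rw [P, map_sum, Finset.sum_range_succ, Finset.sum_eq_zero fun i hi => ?_, zero_add]
  · simp [moebiusNum]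
  · have : f.natDegree - i ≠ 0 := Nat.sub_ne_zero_of_lt (Finset.mem_range.mp hi)
    simp [hx, this]

theorem aeval_P_eq_zero_iff {L : Type*} [Field L] [Algebra F L] (hf : f ≠ 0) {x : L} :
    aeval x (P σ f) = 0 ↔ moebiusDenom σ x ≠ 0 ∧ aeval (moebius σ x) f = 0 := by
  by_cases hx : moebiusDenom σ x = 0
  · simp [aeval_P_of_moebiusDenom_eq_zero f hx, hx, hf,
      moebiusNum_ne_zero_of_moebiusDenom_eq_zero hx]
  · simp [aeval_P f hx, hx]

theorem natDegree_P_le (σ : Matrix.GeneralLinearGroup (Fin 2) F) (f : F[X]) :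
    (P σ f).natDegree ≤ f.natDegree := by
  refine natDegree_sum_le_of_forall_le _ _ fun i hi => ?_
  have hi' : i ≤ f.natDegree := Nat.lt_succ_iff.mp (Finset.mem_range.mp hi)
  compute_degree
  omega

theorem coeff_P_natDegree (hc : σ 1 0 ≠ 0) (f : F[X]) :
    (P σ f).coeff f.natDegree = σ 1 0 ^ f.natDegree * f.eval (σ 0 0 / σ 1 0) := by
  have hdeg (u v : F) (n : ℕ) : ((C u * X + C v) ^ n).natDegree ≤ n := by compute_degree
  have hlin (u v : F) (n : ℕ) : ((C u * X + C v) ^ n).coeff n = u ^ n := by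
    simpa using coeff_pow_of_natDegree_le (m := n) (natDegree_linear_le (a := u) (b := v))
  rw [P, finsetSum_coeff, eval_eq_sum_range, Finset.mul_sum]
  refine Finset.sum_congr rfl fun i hi => ?_
  have hi' : i ≤ f.natDegree := Nat.lt_succ_iff.mp (Finset.mem_range.mp hi)
  have htop := coeff_mul_add_eq_of_natDegree_le (hdeg (σ 0 0) (σ 0 1) i)
    (hdeg (σ 1 0) (σ 1 1) (f.natDegree - i))
  rw [Nat.add_sub_cancel' hi', hlin, hlin] at htop
  rw [mul_assoc, coeff_C_mul, htop, div_pow, pow_sub₀ _ hc hi']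
  field_simp

theorem natDegree_P (hc : σ 1 0 ≠ 0) (hf : f.eval (σ 0 0 / σ 1 0) ≠ 0) :
    (P σ f).natDegree = f.natDegree :=
  (natDegree_P_le σ f).antisymm <| le_natDegree_of_ne_zero <| by
    rw [coeff_P_natDegree hc]
    exact mul_ne_zero (pow_ne_zero _ hc) hf

theorem X_notMem_range_algebraMap :
    (RatFunc.X : RatFunc F) ∉ Set.range (algebraMap F (RatFunc F)) := by
  rintro ⟨a, ha⟩
  exact RatFunc.transcendental_X (K := F) (ha ▸ isAlgebraic_algebraMap a)

theorem eq_of_aeval_ratFuncX_eq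
    (h : aeval (RatFunc.X : RatFunc F) f = aeval (RatFunc.X : RatFunc F) g) : f = g :=
  RatFunc.algebraMap_injective F <| by simpa only [RatFunc.aeval_X_left_eq_algebraMap] using h

theorem P_P (hf : (P τ f).natDegree = f.natDegree) : P σ (P τ f) = P (τ * σ) f := by
  have hden (ρ : Matrix.GeneralLinearGroup (Fin 2) F) :
      moebiusDenom ρ (RatFunc.X : RatFunc F) ≠ 0 :=
    moebiusDenom_ne_zero_of_notMem_range X_notMem_range_algebraMap
  have hσ := moebiusDenom_mul (τ := τ) (hden σ)
  have hτ : moebiusDenom τ (moebius σ (RatFunc.X : RatFunc F)) ≠ 0 :=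
    left_ne_zero_of_mul (hσ ▸ hden (τ * σ))
  apply eq_of_aeval_ratFuncX_eq
  rw [aeval_P _ (hden _), aeval_P _ (hden _), aeval_P _ hτ, hσ, moebius_mul (hden σ), hf]
  ring

theorem P_one (f : F[X]) : P 1 f = f := by
  rw [P]
  conv_rhs => rw [f.as_sum_range_C_mul_X_pow]
  simp

theorem P_inv_P (hf : (P σ f).natDegree = f.natDegree) : P σ⁻¹ (P σ f) = f := by
  rw [P_P hf, mul_inv_cancel, P_one]

theorem P_mul (σ : Matrix.GeneralLinearGroup (Fin 2) F) (f g : F[X]) :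
    P σ (f * g) = P σ f * P σ g := by
  rcases eq_or_ne f 0 with rfl | hf
  · simp [P]
  rcases eq_or_ne g 0 with rfl | hg
  · simp [P]
  have hden : moebiusDenom σ (RatFunc.X : RatFunc F) ≠ 0 :=
    moebiusDenom_ne_zero_of_notMem_range X_notMem_range_algebraMap
  apply eq_of_aeval_ratFuncX_eq
  simp only [map_mul, aeval_P _ hden, natDegree_mul hf hg, pow_add]
  ring

theorem irreducible_P (hf : Irreducible f) (hdeg : (P σ f).natDegree = f.natDegree) :
    Irreducible (P σ f) := by
  refine irreducible_iff.mpr ⟨not_isUnit_of_natDegree_pos _ (hdeg ▸ hf.natDegree_pos), ?_⟩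
  intro u v huv
  have hPf : P σ f ≠ 0 := ne_zero_of_natDegree_gt (hdeg ▸ hf.natDegree_pos)
  obtain ⟨hu, hv⟩ : u ≠ 0 ∧ v ≠ 0 := mul_ne_zero_iff.mp (huv ▸ hPf)
  have hfac : f = P σ⁻¹ u * P σ⁻¹ v := by rw [← P_mul, ← huv, P_inv_P hdeg]
  have hu_le := natDegree_P_le σ⁻¹ u
  have hv_le := natDegree_P_le σ⁻¹ v
  obtain ⟨hPu, hPv⟩ := mul_ne_zero_iff.mp (hfac ▸ hf.ne_zero)
  have hsum : (P σ⁻¹ u).natDegree + (P σ⁻¹ v).natDegree = u.natDegree + v.natDegree := by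
    rw [← natDegree_mul hPu hPv, ← hfac, ← hdeg, huv, natDegree_mul hu hv]
  simp only [isUnit_iff_degree_eq_zero, degree_eq_natDegree hu, degree_eq_natDegree hv]
  refine (hf.isUnit_or_isUnit hfac).imp (fun h => ?_) fun h => ?_ <;>
  · have := natDegree_eq_zero_of_isUnit h
    norm_cast
    omega

theorem gSeq_eq_P_inv_comp (σ : Matrix.GeneralLinearGroup (Fin 2) F) {t : ℕ}
    (hg : (P σ g).natDegree = g.natDegree)
    (hcomp : ∀ k, (P σ⁻¹ ((P σ g).comp (X ^ t ^ k))).natDegree =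
      ((P σ g).comp (X ^ t ^ k)).natDegree) (k : ℕ) :
    gSeq σ t g k = P σ⁻¹ ((P σ g).comp (X ^ t ^ k)) := by
  induction k with
  | zero => rw [gSeq, pow_zero, pow_one, comp_X, P_inv_P hg]
  | succ k ih =>
    have hP := P_inv_P (hcomp k)
    rw [inv_inv] at hP
    rw [gSeq, ih, R, hP, S, comp_assoc, X_pow_comp, ← pow_mul, pow_succ']

end Transform

section CompletelyNormalTransform

variable {F : Type*} [Field F] {σ : Matrix.GeneralLinearGroup (Fin 2) F}

theorem inv_apply_one_zero_ne_zero (hc : σ 1 0 ≠ 0) : σ⁻¹ 1 0 ≠ 0 := by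
  simp [Matrix.coe_units_inv, Matrix.inv_def, Matrix.adjugate_fin_two, hc, σ.det_ne_zero]

theorem inv_apply_zero_zero_div_inv_apply_one_zero : σ⁻¹ 0 0 / σ⁻¹ 1 0 = -σ 1 1 / σ 1 0 := by
  have hdet := inv_ne_zero σ.det_ne_zero
  simp [Matrix.coe_units_inv, Matrix.inv_def, Matrix.adjugate_fin_two, div_neg, neg_div,
    mul_div_mul_left _ _ hdet]

theorem natDegree_P_inv (hc : σ 1 0 ≠ 0) {f : F[X]} (hf : f.eval (-σ 1 1 / σ 1 0) ≠ 0) :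
    (P σ⁻¹ f).natDegree = f.natDegree :=
  natDegree_P (inv_apply_one_zero_ne_zero hc)
    (by rwa [inv_apply_zero_zero_div_inv_apply_one_zero])

theorem exists_moebius_eq_of_aeval_P_inv_eq_zero {L : Type*} [Field L] [Algebra F L] {f : F[X]}
    (hf : f ≠ 0) {α : L} (hα : aeval α (P σ⁻¹ f) = 0) :
    ∃ β : L, moebiusDenom σ β ≠ 0 ∧ moebius σ β = α ∧ aeval β f = 0 := by
  obtain ⟨hden, hroot⟩ := (aeval_P_eq_zero_iff hf).mp hα
  refine ⟨moebius σ⁻¹ α, left_ne_zero_of_mul (b := moebiusDenom σ⁻¹ α) ?_, ?_, hroot⟩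
  · rw [← moebiusDenom_mul hden]
    simp [moebiusDenom]
  · rw [← moebius_mul hden, mul_inv_cancel, moebius_one]

theorem isCompletelyNormalPoly_P_inv_binomial [Finite F] {N : ℕ} {w θ : F}
    (hq : LiftsExponents (Nat.card F) N) (hirr : Irreducible (X ^ N - C θ)) (hw : w ≠ 0)
    (hθ0 : θ ≠ 0) (hc : σ 1 0 ≠ 0) (hd : σ 1 1 ≠ 0) (hθ : θ ≠ (-σ 1 1 / σ 1 0) ^ N)
    (hab : σ 0 0 * θ + σ 0 1 * (-σ 1 1 / σ 1 0) ^ (N - 1) ≠ 0) :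
    IsCompletelyNormalPoly (P σ⁻¹ (C w * (X ^ N - C θ))) := by
  have hN : N ≠ 0 := by simpa using hirr.natDegree_pos.ne'
  have hdeg : (P σ⁻¹ (C w * (X ^ N - C θ))).natDegree = N := by
    rw [natDegree_P_inv hc, natDegree_C_mul hw, natDegree_X_pow_sub_C]
    simpa [hw, sub_eq_zero] using hθ.symm
  have hirr' : Irreducible (C w * (X ^ N - C θ)) :=
    (irreducible_isUnit_mul (isUnit_C.mpr hw.isUnit)).mpr hirr
  refine ⟨irreducible_P hirr' ?_, fun L _ _ hL α hα => ?_⟩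
  · rw [hdeg, natDegree_C_mul hw, natDegree_X_pow_sub_C]
  rw [hdeg] at hL
  obtain ⟨β, hβ, rfl, hroot⟩ := exists_moebius_eq_of_aeval_P_inv_eq_zero hirr'.ne_zero hα
  rw [moebius_eq_add_div hc hβ]
  subst hL
  have : FiniteDimensional F L := Module.finite_of_finrank_pos hN.bot_lt
  refine isCompletelyNormalElement_add_div hq hθ0 hirr ?_ ?_ ?_ hθ ?_
  · simpa [hw, sub_eq_zero] using hroot
  · refine div_ne_zero (fun h0 => det_fin_two_ne_zero σ ?_) (pow_ne_zero 2 hc)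
    linear_combination -h0
  · exact div_ne_zero (neg_ne_zero.mpr hd) hc
  · intro h0
    refine hab (mul_left_cancel₀ hc ?_)
    rw [← mul_pow_sub_one hN] at h0
    generalize (-σ 1 1 / σ 1 0) ^ (Module.finrank F L - 1) = z at h0
    field_simp at h0
    linear_combination h0

end CompletelyNormalTransform

section Eta

variable {F : Type*} [Field F] {σ : Matrix.GeneralLinearGroup (Fin 2) F} {A : F}

theorem eta_X_sub_C (hc : σ 1 0 ≠ 0) (hd : σ 1 1 ≠ 0) :
    eta σ (X - C A) = (σ 1 1 * A - σ 0 1) / (σ 0 0 - σ 1 0 * A) := by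
  have hpole : σ 0 0 - σ 1 0 * A = σ 1 0 * (σ 0 0 / σ 1 0 - A) := by field_simp
  rw [eta, if_neg hc, if_neg hd, hpole]
  simp only [natDegree_X_sub_C, pow_one, eval_sub, eval_X, eval_C]
  field_simp
  ring

theorem P_X_sub_C (hc : σ 1 0 ≠ 0) (hd : σ 1 1 ≠ 0) (hA : σ 0 0 - σ 1 0 * A ≠ 0) :
    P σ (X - C A) = C (σ 0 0 - σ 1 0 * A) * (X - C (eta σ (X - C A))) := by
  rw [mul_sub, ← C_mul, eta_X_sub_C hc hd, mul_div_cancel₀ _ hA, P, natDegree_X_sub_C]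
  simp [Finset.sum_range_succ]
  ring

theorem eta_X_sub_C_ne (hc : σ 1 0 ≠ 0) (hd : σ 1 1 ≠ 0) (hA : σ 0 0 - σ 1 0 * A ≠ 0) :
    eta σ (X - C A) ≠ -σ 1 1 / σ 1 0 := by
  rw [eta_X_sub_C hc hd, Ne, div_eq_div_iff hA hc]
  intro h
  exact det_fin_two_ne_zero σ (by linear_combination h)

theorem mul_eta_X_sub_C_add_ne_zero (hc : σ 1 0 ≠ 0) (hd : σ 1 1 ≠ 0)
    (hA : σ 0 0 - σ 1 0 * A ≠ 0) (hA0 : A ≠ 0) : σ 0 0 * eta σ (X - C A) + σ 0 1 ≠ 0 := by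
  rw [eta_X_sub_C hc hd, mul_div_assoc', div_add' _ _ _ hA]
  refine div_ne_zero (fun h => mul_ne_zero hA0 (det_fin_two_ne_zero σ) ?_) hA
  linear_combination h

theorem mul_add_mul_ne_zero_of_mul_eq_zero (hab : σ 0 0 * σ 0 1 = 0) {x y : F} (hx : x ≠ 0)
    (hy : y ≠ 0) : σ 0 0 * x + σ 0 1 * y ≠ 0 := by
  have hdet := det_fin_two_ne_zero σ
  rcases mul_eq_zero.mp hab with h | h <;> rw [h] at hdet ⊢ <;> simp_all

end Eta

namespace BassaMenares

variable {F : Type*} [Field F] {σ : Matrix.GeneralLinearGroup (Fin 2) F} {t : ℕ} {g : F[X]}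

theorem exponent_ne_one (h : BassaMenares σ t g) : t ≠ 1 := by
  have := h.two_le
  omega

theorem pow_exponent_ne_zero (h : BassaMenares σ t g) (k : ℕ) : t ^ k ≠ 0 :=
  pow_ne_zero k (zero_lt_two.trans_le h.two_le).ne'

theorem liftsExponents [Finite F] (h : BassaMenares σ t g) (hg : Odd g.natDegree) :
    LiftsExponents (Nat.card F) t where
  prime_dvd_sub_one := h.prime_dvd
  four_dvd_sub_one ht := by
    have hq := h.prime_dvd 2 Nat.prime_two ht
    have hq1 : 1 < Nat.card F := Finite.one_lt_card
    have hq3 : Nat.card F % 4 ≠ 3 := fun h3 =>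
      Nat.not_even_iff_odd.mpr hg (h.even_degree h3 (even_iff_two_dvd.mpr ht))
    omega

theorem pow_ne_eta (h : BassaMenares σ t g) {n : ℕ} (hn : n ≠ 1) (hnt : n ∣ t) (y : F) :
    y ^ n ≠ eta σ g := fun hy => by
  obtain ⟨ℓ, hℓ, e, rfl⟩ := Nat.exists_prime_and_dvd hn
  exact h.eta_not_power ℓ hℓ (dvd_of_mul_right_dvd hnt) ⟨y ^ e, by rw [← hy, mul_comm, pow_mul]⟩

theorem eta_ne_zero (h : BassaMenares σ t g) : eta σ g ≠ 0 := fun h0 =>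
  h.pow_ne_eta h.exponent_ne_one dvd_rfl 0
    (by rw [h0, zero_pow (by simpa using h.pow_exponent_ne_zero 1)])

theorem irreducible_X_pow_sub_C_eta [Finite F] (h : BassaMenares σ t g) (hg : Odd g.natDegree)
    (k : ℕ) : Irreducible (X ^ t ^ k - C (eta σ g)) :=
  irreducible_X_pow_sub_C (h.pow_exponent_ne_zero k)
    ((h.liftsExponents hg).pow_right k) h.eta_ne_zero fun _ hp hpt =>
      h.pow_ne_eta hp.ne_one (hp.dvd_of_dvd_pow hpt)

theorem mul_eta_add_mul_pow_ne_zero (h : BassaMenares σ t g) (ha : σ 0 0 ≠ 0) (hc : σ 1 0 ≠ 0)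
    (hd : σ 1 1 ≠ 0) {ℓ : ℕ} (hℓ : ℓ.Prime) (hℓt : ℓ ∣ t) {y : F}
    (hy : σ 0 1 * σ 1 0 / (σ 0 0 * σ 1 1) = y ^ ℓ) {k : ℕ} (hk : k ≠ 0) :
    σ 0 0 * eta σ g + σ 0 1 * (-σ 1 1 / σ 1 0) ^ (t ^ k - 1) ≠ 0 := fun h0 => by
  obtain ⟨e, he⟩ := hℓt.trans (dvd_pow_self t hk)
  refine h.pow_ne_eta hℓ.ne_one hℓt (y * (-σ 1 1 / σ 1 0) ^ e) ?_
  rw [mul_pow, ← hy, ← pow_mul, mul_comm e, ← he, ← mul_pow_sub_one (h.pow_exponent_ne_zero k)]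
  generalize (-σ 1 1 / σ 1 0) ^ (t ^ k - 1) = z at h0
  field_simp
  linear_combination -h0

variable {A : F}

theorem sub_mul_ne_zero (h : BassaMenares σ t (X - C A)) (hc : σ 1 0 ≠ 0) :
    σ 0 0 - σ 1 0 * A ≠ 0 := fun h0 =>
  h.ne_pole hc (by rw [sub_eq_zero.mp h0, mul_div_cancel_left₀ _ hc])

theorem eta_ne_pow_pow (h : BassaMenares σ t (X - C A)) (hc : σ 1 0 ≠ 0) (hd : σ 1 1 ≠ 0)
    (k : ℕ) : eta σ (X - C A) ≠ (-σ 1 1 / σ 1 0) ^ t ^ k := by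
  cases k with
  | zero => simpa using eta_X_sub_C_ne hc hd (h.sub_mul_ne_zero hc)
  | succ k =>
    rw [pow_succ, pow_mul]
    exact (h.pow_ne_eta h.exponent_ne_one dvd_rfl _).symm

theorem gSeq_eq_P_inv_binomial (h : BassaMenares σ t (X - C A)) (hc : σ 1 0 ≠ 0)
    (hd : σ 1 1 ≠ 0) (k : ℕ) :
    gSeq σ t (X - C A) k =
      P σ⁻¹ (C (σ 0 0 - σ 1 0 * A) * (X ^ t ^ k - C (eta σ (X - C A)))) := by
  have hA := h.sub_mul_ne_zero hc
  have hP := P_X_sub_C hc hd hA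
  have hcomp (k : ℕ) : (P σ (X - C A)).comp (X ^ t ^ k) =
      C (σ 0 0 - σ 1 0 * A) * (X ^ t ^ k - C (eta σ (X - C A))) := by simp [hP]
  rw [← hcomp, gSeq_eq_P_inv_comp]
  · rw [hP, natDegree_C_mul hA, natDegree_X_sub_C, natDegree_X_sub_C]
  · intro k
    apply natDegree_P_inv hc
    simpa [hcomp, hA, sub_eq_zero] using (h.eta_ne_pow_pow hc hd k).symm

theorem isCompletelyNormalPoly_gSeq [Finite F] (h : BassaMenares σ t (X - C A)) (hc : σ 1 0 ≠ 0)
    (hd : σ 1 1 ≠ 0) {k : ℕ}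
    (hk : σ 0 0 * eta σ (X - C A) + σ 0 1 * (-σ 1 1 / σ 1 0) ^ (t ^ k - 1) ≠ 0) :
    IsCompletelyNormalPoly (gSeq σ t (X - C A) k) := by
  have hodd : Odd (X - C A).natDegree := by simp
  rw [h.gSeq_eq_P_inv_binomial hc hd]
  exact isCompletelyNormalPoly_P_inv_binomial ((h.liftsExponents hodd).pow_right k)
    (h.irreducible_X_pow_sub_C_eta hodd k) (h.sub_mul_ne_zero hc) h.eta_ne_zero hc hd
    (h.eta_ne_pow_pow hc hd k) hk

end BassaMenares

end RTransform

theorem mainTheorem1 {F : Type*} [Field F] [Finite F] (a b c d A : F)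
    (σ : Matrix.GeneralLinearGroup (Fin 2) F)
    (hσ : (σ : Matrix (Fin 2) (Fin 2) F) = !![a, b; c, d]) (t : ℕ)
    (h : RTransform.BassaMenares σ t (X - C A)) (hdc : d * c ≠ 0) :
    (a * b = 0 →
      ∀ k : ℕ, RTransform.IsCompletelyNormalPoly (RTransform.gSeq σ t (X - C A) k)) ∧
    (a * b ≠ 0 → (∃ ℓ : ℕ, ℓ.Prime ∧ ℓ ∣ t ∧ ∃ y : F, b * c / (a * d) = y ^ ℓ) →
      ∀ k : ℕ, (k ≠ 0 ∨ A ≠ 0) →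
        RTransform.IsCompletelyNormalPoly (RTransform.gSeq σ t (X - C A) k)) ∧
    (a * b ≠ 0 → d = -c → A ≠ 0 →
      ∀ k : ℕ, RTransform.IsCompletelyNormalPoly (RTransform.gSeq σ t (X - C A) k)) := by
  obtain ⟨rfl, rfl, rfl, rfl⟩ : a = σ 0 0 ∧ b = σ 0 1 ∧ c = σ 1 0 ∧ d = σ 1 1 := by simp [hσ]
  obtain ⟨hd, hc⟩ := mul_ne_zero_iff.mp hdc
  have hA := h.sub_mul_ne_zero hc
  have hD : -σ 1 1 / σ 1 0 ≠ 0 := div_ne_zero (neg_ne_zero.mpr hd) hc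
  refine ⟨fun hab k => ?_, fun hab ⟨ℓ, hℓ, hℓt, y, hy⟩ k hk => ?_, fun _ hdc' hA0 k => ?_⟩ <;>
    apply h.isCompletelyNormalPoly_gSeq hc hd
  · exact RTransform.mul_add_mul_ne_zero_of_mul_eq_zero hab h.eta_ne_zero (pow_ne_zero _ hD)
  · rcases eq_or_ne k 0 with rfl | hk0
    · simpa using RTransform.mul_eta_X_sub_C_add_ne_zero hc hd hA (hk.resolve_left (· rfl))
    · exact h.mul_eta_add_mul_pow_ne_zero (left_ne_zero_of_mul hab) hc hd hℓ hℓt hy hk0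
  · have hD1 : -σ 1 1 / σ 1 0 = 1 := by rw [hdc', neg_neg, div_self hc]
    simpa [hD1] using RTransform.mul_eta_X_sub_C_add_ne_zero hc hd hA hA0
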